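/- Consider a bipartite system $\mathbb{C}^{d_A}\otimes\mathbb{C}^{d_B}$. A finite LOCC protocol with output in $[n]=\{1,\dots,n\}$ is a finite-depth procedure in which at each step either Alice or Bob applies to her or his system a local quantum instrument with finitely many outcomes (a finite family of completely positive maps, possibly to spaces of other dimensions, that sum to a trace-preserving map) and communicates the outcome, the subsequent steps depending on the outcomes communicated so far; at the end a label in $[n]$, determined by these outcomes, is output. It implements the measurement (POVM) $\{M_i\}_{i\in[n]}$ for which label $i$ is output on input state $\rho$ with probability $\operatorname{tr}(M_i\rho)$. A measurement is in finite LOCC, $\mathrm{LOCC}_{\mathbb{N}}$, if some finite LOCC protocol implements it, and in asymptotic LOCC, $\overline{\mathrm{LOCC}}$, if it is a limit of a sequence of measurements in $\mathrm{LOCC}_{\mathbb{N}}$ (with the same $d_A$, $d_B$, $n$). (1) Let $\mathcal{M}=\{P_i^A\otimes P_i^B\}_{i\in[n]}$ be a projective measurement on $\mathbb{C}^{d_A}\otimes\mathbb{C}^{d_B}$ (mutually orthogonal projectors that sum to the identity), where $P_i^A$ and $P_i^B$ are orthogonal projectors on $\mathbb{C}^{d_A}$ and $\mathbb{C}^{d_B}$.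 If $\mathcal{M}\in\overline{\mathrm{LOCC}}$, then $\mathcal{M}\in\mathrm{LOCC}_{\mathbb{N}}$. (2) Let $\rho_i=\tau_i\otimes\sigma_i$, $i\in[n]$, be product states (with $\tau_i$, $\sigma_i$ density operators on $\mathbb{C}^{d_A}$, $\mathbb{C}^{d_B}$) that form a full orthogonal set: $\operatorname{tr}(\rho_i\rho_j)=0$ for $i\neq j$, and $\sum_i\rho_i$ has full rank $d_Ad_B$. If some measurement $\{M_i\}_{i\in[n]}$ in $\overline{\mathrm{LOCC}}$ discriminates these states perfectly, i.e. $\operatorname{tr}(M_i\rho_j)=\delta_{ij}$ for all $i,j$, then so does some measurement in $\mathrm{LOCC}_{\mathbb{N}}$. -/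

import Mathlib

open scoped Kronecker Matrix ComplexOrder

namespace LOCC

/-- Operators on the bipartite space `ℂ^dA ⊗ ℂ^dB`. -/
abbrev BipOp (dA dB : ℕ) : Type := Matrix (Fin dA × Fin dB) (Fin dA × Fin dB) ℂ

/-- A quantum instrument on `ℂ^d` with finitely many classical outcomes `j`. On outcome `j` it
applies the completely positive map `X ↦ ∑ k, K j k * X * (K j k)ᴴ` into the operators on
`ℂ^(outDim j)`, and these maps sum up to a trace preserving one. The output dimension is arbitrary,
so that ancillas, partial traces and private memory are all allowed. -/
structure Instrument (d : ℕ) where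
  outcomes : ℕ
  outDim : Fin outcomes → ℕ
  krausCount : Fin outcomes → ℕ
  K : (j : Fin outcomes) → Fin (krausCount j) → Matrix (Fin (outDim j)) (Fin d) ℂ
  trace_preserving : ∑ j, ∑ k, (K j k)ᴴ * K j k = 1

/-- Finite bipartite LOCC protocols on `ℂ^dA ⊗ ℂ^dB` that output a label in `Fin n`. A protocol
either stops and outputs a label, or one of the parties applies a local instrument and communicates
its outcome `j`, whereupon the parties go on with a protocol that may depend on `j`. -/
inductive Protocol (n : ℕ) : ℕ → ℕ → Type
  | output {dA dB : ℕ} (i : Fin n) : Protocol n dA dB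
  | alice {dA dB : ℕ} (J : Instrument dA) (next : ∀ j, Protocol n (J.outDim j) dB) :
      Protocol n dA dB
  | bob {dA dB : ℕ} (J : Instrument dB) (next : ∀ j, Protocol n dA (J.outDim j)) :
      Protocol n dA dB

/-- The measurement (POVM) that a protocol implements: on input state `ρ` the label `i` is output
with probability `tr (P.povm i * ρ)`. -/
def Protocol.povm {n : ℕ} : {dA dB : ℕ} → Protocol n dA dB → Fin n → BipOp dA dB
  | _, _, .output o => fun i => if i = o then 1 else 0
  | _, dB, .alice J next => fun i => ∑ j, ∑ k,
      (J.K j k ⊗ₖ (1 : Matrix (Fin dB) (Fin dB) ℂ))ᴴ * (next j).povm i *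
        (J.K j k ⊗ₖ (1 : Matrix (Fin dB) (Fin dB) ℂ))
  | dA, _, .bob J next => fun i => ∑ j, ∑ k,
      ((1 : Matrix (Fin dA) (Fin dA) ℂ) ⊗ₖ J.K j k)ᴴ * (next j).povm i *
        ((1 : Matrix (Fin dA) (Fin dA) ℂ) ⊗ₖ J.K j k)

/-- `M` can be implemented exactly by a finite LOCC protocol. -/
def IsFiniteLOCC {dA dB n : ℕ} (M : Fin n → BipOp dA dB) : Prop :=
  ∃ P : Protocol n dA dB, P.povm = M

/-- `M` is implemented with vanishing error by a sequence of finite LOCC protocols. -/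
def IsAsymptoticLOCC {dA dB n : ℕ} (M : Fin n → BipOp dA dB) : Prop :=
  ∃ P : ℕ → Protocol n dA dB,
    Filter.Tendsto (fun t => (P t).povm) Filter.atTop (nhds M)

/-- A projective measurement: mutually orthogonal orthogonal projectors that sum to the identity. -/
structure IsProjectiveMeasurement {dA dB n : ℕ} (M : Fin n → BipOp dA dB) : Prop where
  isProj : ∀ i, IsStarProjection (M i)
  orthogonal : ∀ i j, i ≠ j → M i * M j = 0
  sum_eq_one : ∑ i, M i = 1

/-- Density operators. -/
def IsState {ι : Type*} [Fintype ι] (ρ : Matrix ι ι ℂ) : Prop :=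
  ρ.PosSemidef ∧ ρ.trace = 1

/-- A full orthogonal set of bipartite states: mutually orthogonal states whose sum has full rank. -/
structure IsFullOrthogonalSet {dA dB n : ℕ} (ρ : Fin n → BipOp dA dB) : Prop where
  isState : ∀ i, IsState (ρ i)
  orthogonal : ∀ i j, i ≠ j → (ρ i * ρ j).trace = 0
  full_rank : (∑ i, ρ i).rank = dA * dB

/-- The measurement `M` identifies the index `i` of the state `ρ i` without error. -/
def Discriminates {dA dB n : ℕ} (M ρ : Fin n → BipOp dA dB) : Prop :=
  ∀ i j, (M i * ρ j).trace = if i = j then 1 else 0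

end LOCC

/-! Along a branch of a protocol let `A ⊗ₖ B` be the accumulated Kraus operator, and let a, b be `Aᴴ
* A`, `Bᴴ * B` rescaled to the trace of the identity, so that (a, b) starts at (1, 1). If the rest
of the protocol errs little, a ⊗ b almost commutes with every effect (`norm_corner_le`). A step may
be large, but it moves only a or only b, and a ⊗ b is affine on the segment between the old and the
new pair. Almost commutation therefore holds on the whole segment, and no sphere around (1, 1) can
be jumped over. Hence if a small sphere contains no almost commuting pair, every branch either errs
noticeably or ends near (1, 1), where any output is wrong for some other nonzero effect with
probability bounded below (`le_loss_of_forall_dist_ne`). This bounds the error of all protocols from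
below, which is impossible for a measurement in asymptotic LOCC. Compactness then yields an exactly
commuting pair other than (1, 1) (`exists_commuting`).

A partial trace shows that a nonscalar factor of this pair commutes with all relevant local
projectors of its party. Measuring a splitting into sums of its eigenspaces disturbs no effect, and
on each block the compressed measurement is again a product projective measurement in asymptotic
LOCC. Induction on `dA + dB` gives a finite protocol (`asymptoticSuffices`).

For part (2), orthogonality and full rank force a discriminating measurement to consist of the
support projections of the states (`exists_projective_of_discriminates`). These are products, so
part (1) applies to it. -/

namespace LOCC

/-! ### Hilbert–Schmidt weights of Kraus operators. -/

section Weight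

variable {m n p q : Type*} [Fintype m] [Fintype n] [Fintype p] [Fintype q]

/-- The squared Hilbert–Schmidt norm of a matrix. -/
noncomputable def wt (X : Matrix m n ℂ) : ℝ := (Xᴴ * X).trace.re

theorem wt_eq_sum (X : Matrix m n ℂ) : wt X = ∑ j, ∑ i, ‖X i j‖ ^ 2 := by
  simp only [wt, Matrix.trace, Matrix.diag, Matrix.mul_apply, Matrix.conjTranspose_apply,
    Complex.re_sum]
  refine Finset.sum_congr rfl fun j _ => Finset.sum_congr rfl fun i _ => ?_
  rw [← Complex.normSq_eq_norm_sq, Complex.normSq_apply]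
  simp

theorem wt_nonneg (X : Matrix m n ℂ) : 0 ≤ wt X := by
  rw [wt_eq_sum]; positivity

theorem wt_eq_zero {X : Matrix m n ℂ} (h : wt X = 0) : X = 0 := by
  rw [wt_eq_sum, Finset.sum_eq_zero_iff_of_nonneg (fun _ _ => by positivity)] at h
  ext i j
  have h1 := h j (Finset.mem_univ j)
  rw [Finset.sum_eq_zero_iff_of_nonneg (fun _ _ => by positivity)] at h1
  simpa using h1 i (Finset.mem_univ i)

theorem trace_conjTranspose_mul_self (X : Matrix m n ℂ) : (Xᴴ * X).trace = (wt X : ℂ) := by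
  have h : star (Xᴴ * X).trace = (Xᴴ * X).trace := by
    rw [← Matrix.trace_conjTranspose]; simp
  exact (Complex.conj_eq_iff_re.mp h).symm

theorem wt_kronecker (A : Matrix m n ℂ) (B : Matrix p q ℂ) : wt (A ⊗ₖ B) = wt A * wt B := by
  have h : (wt (A ⊗ₖ B) : ℂ) = (wt A * wt B : ℝ) := by
    push_cast
    rw [← trace_conjTranspose_mul_self, ← trace_conjTranspose_mul_self,
      ← trace_conjTranspose_mul_self, Matrix.conjTranspose_kronecker, ← Matrix.mul_kronecker_mul,
      Matrix.trace_kronecker]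
  exact_mod_cast h

theorem sum_norm_sq_le_wt (X : Matrix m n ℂ) (j : n) : ∑ i, ‖X i j‖ ^ 2 ≤ wt X := by
  rw [wt_eq_sum]
  exact Finset.single_le_sum (f := fun j => ∑ i, ‖X i j‖ ^ 2) (fun _ _ => by positivity)
    (Finset.mem_univ j)

/-- Cauchy–Schwarz weakened by the inequality of means with a free parameter `s`. Unlike a geometric
mean, the bound is linear in the two weights, so it can be summed over the branches of a protocol.
-/
theorem norm_conjTranspose_mul_apply_le (X : Matrix m n ℂ) (Y : Matrix m p ℂ) (k : n) (l : p)
    {s : ℝ} (hs : 0 < s) : ‖(Xᴴ * Y) k l‖ ≤ wt X / s + s * wt Y := by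
  calc ‖(Xᴴ * Y) k l‖ ≤ ∑ i, ‖X i k‖ * ‖Y i l‖ := by
        rw [Matrix.mul_apply]
        refine (norm_sum_le _ _).trans (le_of_eq ?_)
        simp
    _ ≤ ∑ i, (‖X i k‖ ^ 2 / s + s * ‖Y i l‖ ^ 2) := by
        refine Finset.sum_le_sum fun i _ => ?_
        have h : ‖X i k‖ ^ 2 / s + s * ‖Y i l‖ ^ 2 - ‖X i k‖ * ‖Y i l‖ =
            ((‖X i k‖ - s * ‖Y i l‖) ^ 2 + ‖X i k‖ * (s * ‖Y i l‖)) / s := by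
          field_simp; ring
        have : 0 ≤ ((‖X i k‖ - s * ‖Y i l‖) ^ 2 + ‖X i k‖ * (s * ‖Y i l‖)) / s := by positivity
        linarith
    _ = (∑ i, ‖X i k‖ ^ 2) / s + s * ∑ i, ‖Y i l‖ ^ 2 := by
        rw [Finset.sum_add_distrib, Finset.sum_div, Finset.mul_sum]
    _ ≤ _ := by
        gcongr
        · exact sum_norm_sq_le_wt X k
        · exact sum_norm_sq_le_wt Y l

theorem trace_mul_starProjection_re (X : Matrix m n ℂ) {R : Matrix n n ℂ}
    (hR : IsStarProjection R) : (Xᴴ * X * R).trace.re = wt (X * R) := by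
  have h1 : R * R = R := hR.1
  have h2 : Rᴴ = R := hR.2
  rw [wt, Matrix.conjTranspose_mul, h2, Matrix.mul_assoc R, Matrix.trace_mul_comm R]
  simp only [Matrix.mul_assoc, h1]

theorem wt_mul_starProjection_le [DecidableEq n] (X : Matrix m n ℂ) {R : Matrix n n ℂ}
    (hR : IsStarProjection R) : wt (X * R) ≤ wt X := by
  have h := trace_mul_starProjection_re X hR.one_sub
  rw [Matrix.mul_sub, Matrix.mul_one, Matrix.trace_sub, Complex.sub_re,
    trace_mul_starProjection_re X hR] at h
  have := wt_nonneg (X * (1 - R))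
  have h3 : wt X = (Xᴴ * X).trace.re := rfl
  linarith

end Weight

variable {n dA dB : ℕ}

/-! ### Error of a protocol and its control of commutation. -/

section Loss

theorem Instrument.sum_conj {d e : ℕ} (J : Instrument d) (A : Matrix (Fin d) (Fin e) ℂ) :
    ∑ j, ∑ k, (J.K j k * A)ᴴ * (J.K j k * A) = Aᴴ * A := by
  calc _ = ∑ j, ∑ k, Aᴴ * ((J.K j k)ᴴ * J.K j k) * A := by
        simp only [Matrix.conjTranspose_mul, Matrix.mul_assoc]
    _ = Aᴴ * (∑ j, ∑ k, (J.K j k)ᴴ * J.K j k) * A := by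
        simp only [Matrix.mul_sum, Matrix.sum_mul]
    _ = _ := by rw [J.trace_preserving, Matrix.mul_one]

theorem Instrument.sum_wt {d e : ℕ} (J : Instrument d) (A : Matrix (Fin d) (Fin e) ℂ) :
    ∑ j, ∑ k, wt (J.K j k * A) = wt A := by
  rw [wt, ← J.sum_conj A]
  simp only [Matrix.trace_sum, Complex.re_sum, wt]

/-- The unnormalised probability, summed over the labels `i`, that the protocol `P`, run after the
local Kraus operators `A` and `B`, outputs a label other than `i` on the input `R i`. -/
noncomputable def loss (R : Fin n → BipOp dA dB) {dA' dB' : ℕ} (P : Protocol n dA' dB')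
    (A : Matrix (Fin dA') (Fin dA) ℂ) (B : Matrix (Fin dB') (Fin dB) ℂ) : ℝ :=
  ∑ o, ∑ i ∈ Finset.univ.erase o, ((A ⊗ₖ B)ᴴ * P.povm o * (A ⊗ₖ B) * R i).trace.re

variable {R : Fin n → BipOp dA dB} {dA' dB' : ℕ}

theorem loss_output (hR : ∀ i, IsStarProjection (R i)) (o : Fin n)
    (A : Matrix (Fin dA') (Fin dA) ℂ) (B : Matrix (Fin dB') (Fin dB) ℂ) :
    loss R (.output o) A B = ∑ i ∈ Finset.univ.erase o, wt ((A ⊗ₖ B) * R i) := by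
  rw [loss, Finset.sum_eq_single o]
  · simp only [Protocol.povm, if_true, Matrix.mul_one]
    exact Finset.sum_congr rfl fun i _ => trace_mul_starProjection_re _ (hR i)
  · intro b _ hb
    simp [Protocol.povm, hb]
  · simp

/-- Kraus operators are absorbed into `A`, so the loss is additive over branches, just as the weight
is by `Instrument.sum_wt`. This makes induction on protocols possible. -/
theorem loss_alice (J : Instrument dA') (next : ∀ j, Protocol n (J.outDim j) dB')
    (A : Matrix (Fin dA') (Fin dA) ℂ) (B : Matrix (Fin dB') (Fin dB) ℂ) :
    loss R (.alice J next) A B = ∑ j, ∑ k, loss R (next j) (J.K j k * A) B := by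
  have h : ∀ o i, ((A ⊗ₖ B)ᴴ * (Protocol.alice J next).povm o * (A ⊗ₖ B) * R i).trace.re =
      ∑ j, ∑ k, (((J.K j k * A) ⊗ₖ B)ᴴ * (next j).povm o * ((J.K j k * A) ⊗ₖ B) * R i).trace.re := by
    intro o i
    have h1 : ∀ j k, (J.K j k * A) ⊗ₖ B =
        (J.K j k ⊗ₖ (1 : Matrix (Fin dB') (Fin dB') ℂ)) * (A ⊗ₖ B) := fun j k => by
      rw [← Matrix.mul_kronecker_mul, Matrix.one_mul]
    simp only [Protocol.povm, h1, Matrix.mul_sum, Matrix.sum_mul, Matrix.trace_sum, Complex.re_sum,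
      Matrix.conjTranspose_mul, Matrix.mul_assoc]
  simp only [loss, h]
  rw [Finset.sum_congr rfl fun o _ => Finset.sum_comm, Finset.sum_comm]
  refine Finset.sum_congr rfl fun j _ => ?_
  rw [Finset.sum_congr rfl fun o _ => Finset.sum_comm, Finset.sum_comm]

theorem loss_bob (J : Instrument dB') (next : ∀ j, Protocol n dA' (J.outDim j))
    (A : Matrix (Fin dA') (Fin dA) ℂ) (B : Matrix (Fin dB') (Fin dB) ℂ) :
    loss R (.bob J next) A B = ∑ j, ∑ k, loss R (next j) A (J.K j k * B) := by
  have h : ∀ o i, ((A ⊗ₖ B)ᴴ * (Protocol.bob J next).povm o * (A ⊗ₖ B) * R i).trace.re =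
      ∑ j, ∑ k, ((A ⊗ₖ (J.K j k * B))ᴴ * (next j).povm o * (A ⊗ₖ (J.K j k * B)) * R i).trace.re := by
    intro o i
    have h1 : ∀ j k, A ⊗ₖ (J.K j k * B) =
        ((1 : Matrix (Fin dA') (Fin dA') ℂ) ⊗ₖ J.K j k) * (A ⊗ₖ B) := fun j k => by
      rw [← Matrix.mul_kronecker_mul, Matrix.one_mul]
    simp only [Protocol.povm, h1, Matrix.mul_sum, Matrix.sum_mul, Matrix.trace_sum, Complex.re_sum,
      Matrix.conjTranspose_mul, Matrix.mul_assoc]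
  simp only [loss, h]
  rw [Finset.sum_congr rfl fun o _ => Finset.sum_comm, Finset.sum_comm]
  refine Finset.sum_congr rfl fun j _ => ?_
  rw [Finset.sum_congr rfl fun o _ => Finset.sum_comm, Finset.sum_comm]

theorem loss_nonneg (hR : ∀ i, IsStarProjection (R i)) (P : Protocol n dA' dB')
    (A : Matrix (Fin dA') (Fin dA) ℂ) (B : Matrix (Fin dB') (Fin dB) ℂ) : 0 ≤ loss R P A B := by
  induction P with
  | output o => rw [loss_output hR]; exact Finset.sum_nonneg fun _ _ => wt_nonneg _
  | alice J next ih =>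
    rw [loss_alice]; exact Finset.sum_nonneg fun j _ => Finset.sum_nonneg fun k _ => ih j _ _
  | bob J next ih =>
    rw [loss_bob]; exact Finset.sum_nonneg fun j _ => Finset.sum_nonneg fun k _ => ih j _ _

theorem single_wt_le_loss (hR : ∀ i, IsStarProjection (R i)) {o i : Fin n} (hi : i ≠ o)
    (A : Matrix (Fin dA') (Fin dA) ℂ) (B : Matrix (Fin dB') (Fin dB) ℂ) :
    wt ((A ⊗ₖ B) * R i) ≤ loss R (.output o) A B := by
  rw [loss_output hR]
  exact Finset.single_le_sum (f := fun i => wt ((A ⊗ₖ B) * R i)) (fun _ _ => wt_nonneg _)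
    (Finset.mem_erase.mpr ⟨hi, Finset.mem_univ i⟩)

/-- If little is lost then the operator accumulated so far almost commutes with all `R i`. -/
theorem norm_corner_le (hR : ∀ i, IsStarProjection (R i)) (P : Protocol n dA' dB')
    (A : Matrix (Fin dA') (Fin dA) ℂ) (B : Matrix (Fin dB') (Fin dB) ℂ) {s : ℝ} (hs : 0 < s)
    {i j : Fin n} (hij : i ≠ j) (x y : Fin dA × Fin dB) :
    ‖(R i * ((Aᴴ * A) ⊗ₖ (Bᴴ * B)) * R j) x y‖ ≤ loss R P A B / s + s * (wt A * wt B) := by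
  induction P with
  | output o =>
    have hE : R i * ((Aᴴ * A) ⊗ₖ (Bᴴ * B)) * R j = ((A ⊗ₖ B) * R i)ᴴ * ((A ⊗ₖ B) * R j) := by
      rw [Matrix.conjTranspose_mul, show (R i)ᴴ = R i from (hR i).2,
        Matrix.mul_kronecker_mul, Matrix.conjTranspose_kronecker]
      simp only [Matrix.mul_assoc]
    have hw : ∀ i, wt ((A ⊗ₖ B) * R i) ≤ wt A * wt B := fun i => by
      rw [← wt_kronecker]; exact wt_mul_starProjection_le _ (hR i)
    -- At least one of `i`, `j` differs from the output `o`, and the weight of that factor is part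
    -- of the loss. If it is `j`, the adjoint entry brings it to the front.
    by_cases hi : i = o
    · have hj : j ≠ o := fun h => hij (hi.trans h.symm)
      have hE' : ‖(R i * ((Aᴴ * A) ⊗ₖ (Bᴴ * B)) * R j) x y‖ =
          ‖(((A ⊗ₖ B) * R j)ᴴ * ((A ⊗ₖ B) * R i)) y x‖ := by
        rw [hE, ← norm_star, ← Matrix.conjTranspose_apply, Matrix.conjTranspose_mul,
          Matrix.conjTranspose_conjTranspose]
      rw [hE']
      refine (norm_conjTranspose_mul_apply_le _ _ y x hs).trans ?_
      gcongr
      · exact single_wt_le_loss hR hj A B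
      · exact hw i
    · rw [hE]
      refine (norm_conjTranspose_mul_apply_le _ _ x y hs).trans ?_
      gcongr
      · exact single_wt_le_loss hR hi A B
      · exact hw j
  | alice J next ih =>
    rw [loss_alice, ← J.sum_wt A, ← J.sum_conj A]
    have h : (R i * ((∑ a, ∑ k, (J.K a k * A)ᴴ * (J.K a k * A)) ⊗ₖ (Bᴴ * B)) * R j) x y =
        ∑ a, ∑ k, (R i * (((J.K a k * A)ᴴ * (J.K a k * A)) ⊗ₖ (Bᴴ * B)) * R j) x y := by
      have h1 : ∀ {ι : Type} (s : Finset ι) (f : ι → Matrix (Fin dA) (Fin dA) ℂ),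
          (∑ a ∈ s, f a) ⊗ₖ (Bᴴ * B) = ∑ a ∈ s, f a ⊗ₖ (Bᴴ * B) := fun s f => by
        ext; simp [Matrix.sum_apply, Finset.sum_mul]
      simp only [h1, Matrix.mul_sum, Matrix.sum_mul, Matrix.sum_apply]
    rw [h]
    refine (norm_sum_le _ _).trans ?_
    simp only [Finset.sum_mul, Finset.mul_sum, Finset.sum_div, ← Finset.sum_add_distrib]
    refine Finset.sum_le_sum fun a _ => (norm_sum_le _ _).trans ?_
    exact Finset.sum_le_sum fun k _ => ih a _ _
  | bob J next ih =>
    rw [loss_bob, ← J.sum_wt B, ← J.sum_conj B]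
    have h : (R i * ((Aᴴ * A) ⊗ₖ (∑ a, ∑ k, (J.K a k * B)ᴴ * (J.K a k * B))) * R j) x y =
        ∑ a, ∑ k, (R i * ((Aᴴ * A) ⊗ₖ ((J.K a k * B)ᴴ * (J.K a k * B))) * R j) x y := by
      have h1 : ∀ {ι : Type} (s : Finset ι) (f : ι → Matrix (Fin dB) (Fin dB) ℂ),
          (Aᴴ * A) ⊗ₖ (∑ a ∈ s, f a) = ∑ a ∈ s, (Aᴴ * A) ⊗ₖ f a := fun s f => by
        ext; simp [Matrix.sum_apply, Finset.mul_sum]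
      simp only [h1, Matrix.mul_sum, Matrix.sum_mul, Matrix.sum_apply]
    rw [h]
    refine (norm_sum_le _ _).trans ?_
    simp only [Finset.mul_sum, Finset.sum_div, ← Finset.sum_add_distrib]
    refine Finset.sum_le_sum fun a _ => (norm_sum_le _ _).trans ?_
    exact Finset.sum_le_sum fun k _ => ih a _ _

end Loss

/-! ### From vanishing error to an exactly commuting product operator. -/

section Commuting

/-- Pairs of Hermitian operators, normalised like the identity, whose tensor product commutes with
all `R i` up to an error `ε`. -/
structure AlmostCommutes (R : Fin n → BipOp dA dB) (ε : ℝ)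
    (p : Matrix (Fin dA) (Fin dA) ℂ × Matrix (Fin dB) (Fin dB) ℂ) : Prop where
  herm_fst : p.1ᴴ = p.1
  herm_snd : p.2ᴴ = p.2
  trace_fst : p.1.trace = dA
  trace_snd : p.2.trace = dB
  corner : ∀ i j, i ≠ j → ∀ x y, ‖(R i * (p.1 ⊗ₖ p.2) * R j) x y‖ ≤ ε

variable {R : Fin n → BipOp dA dB} {dA' dB' : ℕ}

/-- The tensor product is affine on a segment along which one factor is fixed, and the remaining
conditions are convex. This is where the locality of each step enters. -/
theorem AlmostCommutes.segment {ε : ℝ}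
    {p q : Matrix (Fin dA) (Fin dA) ℂ × Matrix (Fin dB) (Fin dB) ℂ}
    (hp : AlmostCommutes R ε p) (hq : AlmostCommutes R ε q) (hpq : p.1 = q.1 ∨ p.2 = q.2)
    {t : ℝ} (h0 : 0 ≤ t) (h1 : t ≤ 1) : AlmostCommutes R ε ((1 - t) • p + t • q) := by
  have hk : ((1 - t) • p + t • q).1 ⊗ₖ ((1 - t) • p + t • q).2 =
      (1 - t) • (p.1 ⊗ₖ p.2) + t • (q.1 ⊗ₖ q.2) := by
    ext x y
    rcases hpq with h | h <;>
    · simp [h]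
      ring
  have ht : ∀ z : ℂ, (1 - t) • z + t • z = z := fun z => by
    rw [← add_smul, sub_add_cancel, one_smul]
  refine ⟨?_, ?_, ?_, ?_, fun i j hij x y => ?_⟩
  · simp [Matrix.conjTranspose_add, Matrix.conjTranspose_smul, hp.herm_fst, hq.herm_fst]
  · simp [Matrix.conjTranspose_add, Matrix.conjTranspose_smul, hp.herm_snd, hq.herm_snd]
  · rw [Prod.fst_add, Prod.smul_fst, Prod.smul_fst, Matrix.trace_add, Matrix.trace_smul,
      Matrix.trace_smul, hp.trace_fst, hq.trace_fst, ht]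
  · rw [Prod.snd_add, Prod.smul_snd, Prod.smul_snd, Matrix.trace_add, Matrix.trace_smul,
      Matrix.trace_smul, hp.trace_snd, hq.trace_snd, ht]
  · rw [hk, Matrix.mul_add, Matrix.add_mul, Matrix.mul_smul, Matrix.mul_smul, Matrix.smul_mul,
      Matrix.smul_mul, Matrix.add_apply, Matrix.smul_apply, Matrix.smul_apply]
    refine (norm_add_le _ _).trans ?_
    rw [norm_smul, norm_smul, Real.norm_of_nonneg h0, Real.norm_of_nonneg (sub_nonneg.mpr h1)]
    calc _ ≤ (1 - t) * ε + t * ε := by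
          have := sub_nonneg.mpr h1
          gcongr
          · exact hp.corner i j hij x y
          · exact hq.corner i j hij x y
      _ = ε := by ring

/-- The operator `Aᴴ * A`, rescaled to have the trace of the identity. -/
noncomputable def normalized {m d : ℕ} (A : Matrix (Fin m) (Fin d) ℂ) :
    Matrix (Fin d) (Fin d) ℂ := (d / wt A : ℝ) • (Aᴴ * A)

theorem normalized_herm {m d : ℕ} (A : Matrix (Fin m) (Fin d) ℂ) :
    (normalized A)ᴴ = normalized A := by
  simp [normalized, Matrix.conjTranspose_smul, Matrix.conjTranspose_mul]

theorem normalized_trace {m d : ℕ} {A : Matrix (Fin m) (Fin d) ℂ} (hA : 0 < wt A) :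
    (normalized A).trace = d := by
  have : (wt A : ℂ) ≠ 0 := by exact_mod_cast hA.ne'
  rw [normalized, Matrix.trace_smul, trace_conjTranspose_mul_self, Complex.real_smul]
  push_cast
  field_simp

theorem wt_one (d : ℕ) : wt (1 : Matrix (Fin d) (Fin d) ℂ) = d := by
  simp [wt]

theorem normalized_one {d : ℕ} (hd : 0 < d) : normalized (1 : Matrix (Fin d) (Fin d) ℂ) = 1 := by
  have : (d : ℝ) ≠ 0 := by exact_mod_cast hd.ne'
  simp [normalized, wt_one, this]

theorem wt_mul_eq_trace_normalized {m d : ℕ} {A : Matrix (Fin m) (Fin d) ℂ} (hA : 0 < wt A)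
    (hd : 0 < d) {Q : Matrix (Fin d) (Fin d) ℂ} (hQ : IsStarProjection Q) :
    wt (A * Q) = wt A / d * (normalized A * Q).trace.re := by
  have : (d : ℝ) ≠ 0 := by exact_mod_cast hd.ne'
  rw [normalized, Matrix.smul_mul, Matrix.trace_smul, Complex.smul_re,
    trace_mul_starProjection_re _ hQ, smul_eq_mul]
  have := hA.ne'
  field_simp

theorem almostCommutes_normalized (hR : ∀ i, IsStarProjection (R i)) {P : Protocol n dA' dB'}
    {A : Matrix (Fin dA') (Fin dA) ℂ} {B : Matrix (Fin dB') (Fin dB) ℂ} (hA : 0 < wt A)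
    (hB : 0 < wt B) {s : ℝ} (hs : 0 < s) (hloss : loss R P A B ≤ s ^ 2 * (wt A * wt B)) :
    AlmostCommutes R (2 * s * (dA * dB)) (normalized A, normalized B) := by
  refine ⟨normalized_herm A, normalized_herm B, normalized_trace hA, normalized_trace hB,
    fun i j hij x y => ?_⟩
  have hk : R i * (normalized A ⊗ₖ normalized B) * R j =
      ((dA / wt A) * (dB / wt B) : ℝ) • (R i * ((Aᴴ * A) ⊗ₖ (Bᴴ * B)) * R j) := by
    rw [normalized, normalized, Matrix.smul_kronecker, Matrix.kronecker_smul, smul_smul,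
      Matrix.mul_smul, Matrix.smul_mul]
  rw [hk, Matrix.smul_apply, norm_smul, Real.norm_of_nonneg (by positivity)]
  -- With loss at most `s ^ 2` times the weight, both terms of `norm_corner_le` are at most `s`
  -- times the weight, whence the factor 2.
  calc _ ≤ (dA / wt A) * (dB / wt B) * (s ^ 2 * (wt A * wt B) / s + s * (wt A * wt B)) := by
        gcongr
        refine (norm_corner_le hR P A B hs hij x y).trans ?_
        gcongr
    _ = _ := by
        have := hA.ne'
        have := hB.ne'
        field_simp
        ring

open scoped Matrix.Norms.Elementwise

/-- Intermediate value theorem on the segment from `p` to `q`. -/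
theorem exists_dist_eq_of_almostCommutes {ε δ : ℝ}
    {p q : Matrix (Fin dA) (Fin dA) ℂ × Matrix (Fin dB) (Fin dB) ℂ}
    (hp : AlmostCommutes R ε p) (hq : AlmostCommutes R ε q) (hpq : p.1 = q.1 ∨ p.2 = q.2)
    (hpδ : dist p 1 ≤ δ) (hqδ : δ ≤ dist q 1) : ∃ r, AlmostCommutes R ε r ∧ dist r 1 = δ := by
  have hc : ContinuousOn (fun t : ℝ => dist ((1 - t) • p + t • q) 1) (Set.Icc 0 1) := by fun_prop
  obtain ⟨t, ht, hδ⟩ := intermediate_value_Icc zero_le_one hc (show δ ∈ _ from by simp [hpδ, hqδ])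
  exact ⟨_, hp.segment hq hpq ht.1 ht.2, hδ⟩

/-- If no almost commuting pair is at distance `δ` from the identity, then a protocol that is run
while the accumulated operators are `δ`-close to the identity loses a fixed fraction. -/
theorem le_loss_of_forall_dist_ne (hR : ∀ i, IsStarProjection (R i)) {δ s κ : ℝ} (hs : 0 < s)
    (hκs : κ ≤ s ^ 2)
    (hleaf : ∀ {dA' dB' : ℕ} (A : Matrix (Fin dA') (Fin dA) ℂ) (B : Matrix (Fin dB') (Fin dB) ℂ)
      (o : Fin n), 0 < wt A → 0 < wt B → dist (normalized A, normalized B) 1 ≤ δ →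
      κ * (wt A * wt B) ≤ loss R (.output o) A B)
    (hne : ∀ r, AlmostCommutes R (2 * s * (dA * dB)) r → dist r 1 ≠ δ)
    (P : Protocol n dA' dB') (A : Matrix (Fin dA') (Fin dA) ℂ) (B : Matrix (Fin dB') (Fin dB) ℂ)
    (hA : 0 < wt A) (hB : 0 < wt B) (hnear : dist (normalized A, normalized B) 1 ≤ δ) :
    κ * (wt A * wt B) ≤ loss R P A B := by
  have big : ∀ {dA' dB' : ℕ} {P : Protocol n dA' dB'} {A : Matrix (Fin dA') (Fin dA) ℂ}
      {B : Matrix (Fin dB') (Fin dB) ℂ}, s ^ 2 * (wt A * wt B) ≤ loss R P A B →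
      κ * (wt A * wt B) ≤ loss R P A B := fun h =>
    (mul_le_mul_of_nonneg_right hκs (mul_nonneg (wt_nonneg _) (wt_nonneg _))).trans h
  induction P with
  | output o => exact hleaf A B o hA hB hnear
  | alice J next ih =>
    rcases le_total (s ^ 2 * (wt A * wt B)) (loss R (.alice J next) A B) with h | h
    · exact big h
    have hp := almostCommutes_normalized hR hA hB hs h
    rw [loss_alice, ← J.sum_wt A]
    simp only [Finset.sum_mul, Finset.mul_sum]
    refine Finset.sum_le_sum fun j _ => Finset.sum_le_sum fun k _ => ?_
    -- A branch of weight zero has no normalized operator, but its share of the lower bound is zero.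
    rcases (wt_nonneg (J.K j k * A)).eq_or_lt with h0 | h0
    · rw [← h0]; simpa using loss_nonneg hR (next j) _ _
    rcases le_total (s ^ 2 * (wt (J.K j k * A) * wt B)) (loss R (next j) (J.K j k * A) B) with h | h
    · exact big h
    have hq := almostCommutes_normalized hR h0 hB hs h
    -- Both ends of the step almost commute, so leaving the `δ`-ball would produce an almost
    -- commuting pair on the sphere.
    rcases le_total (dist (normalized (J.K j k * A), normalized B) 1) δ with h1 | h1
    · exact ih j _ _ h0 hB h1
    · obtain ⟨r, hr, hrδ⟩ := exists_dist_eq_of_almostCommutes hp hq (Or.inr rfl) hnear h1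
      exact absurd hrδ (hne r hr)
  | bob J next ih =>
    rcases le_total (s ^ 2 * (wt A * wt B)) (loss R (.bob J next) A B) with h | h
    · exact big h
    have hp := almostCommutes_normalized hR hA hB hs h
    rw [loss_bob, ← J.sum_wt B]
    simp only [Finset.mul_sum]
    refine Finset.sum_le_sum fun j _ => Finset.sum_le_sum fun k _ => ?_
    rcases (wt_nonneg (J.K j k * B)).eq_or_lt with h0 | h0
    · rw [← h0]; simpa using loss_nonneg hR (next j) _ _
    rcases le_total (s ^ 2 * (wt A * wt (J.K j k * B))) (loss R (next j) A (J.K j k * B)) with h | h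
    · exact big h
    have hq := almostCommutes_normalized hR hA h0 hs h
    rcases le_total (dist (normalized A, normalized (J.K j k * B)) 1) δ with h1 | h1
    · exact ih j _ _ hA h0 h1
    · obtain ⟨r, hr, hrδ⟩ := exists_dist_eq_of_almostCommutes hp hq (Or.inl rfl) hnear h1
      exact absurd hrδ (hne r hr)

theorem tendsto_loss {M : Fin n → BipOp dA dB} {P : ℕ → Protocol n dA dB}
    (hP : Filter.Tendsto (fun t => (P t).povm) Filter.atTop (nhds M)) :
    Filter.Tendsto (fun t => loss R (P t) 1 1) Filter.atTop
      (nhds (∑ o, ∑ i ∈ Finset.univ.erase o, (M o * R i).trace.re)) := by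
  simp only [loss, Matrix.one_kronecker_one, Matrix.conjTranspose_one, Matrix.one_mul,
    Matrix.mul_one]
  refine tendsto_finsetSum _ fun o _ => tendsto_finsetSum _ fun i _ => ?_
  have hc : Continuous fun X : BipOp dA dB => (X * R i).trace.re :=
    Complex.continuous_re.comp (Continuous.matrix_trace (by fun_prop))
  exact (hc.tendsto _).comp ((tendsto_pi_nhds.mp hP) o)

/-- The pairs at distance `δ` from the identity are compact, so that approximate commutation to any
precision gives exact commutation. -/
theorem exists_commuting_of_forall_almostCommutes {δ : ℝ}
    (h : ∀ ε > 0, ∃ r, AlmostCommutes R ε r ∧ dist r 1 = δ) :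
    ∃ r, AlmostCommutes R 0 r ∧ dist r 1 = δ := by
  choose r hr hδ using fun k : ℕ => h (1 / (k + 1)) (by positivity)
  have hK : IsCompact (Metric.sphere
      (1 : Matrix (Fin dA) (Fin dA) ℂ × Matrix (Fin dB) (Fin dB) ℂ) δ) := isCompact_sphere _ _
  have : ∀ d, FirstCountableTopology (Matrix (Fin d) (Fin d) ℂ) := fun d =>
    inferInstanceAs (FirstCountableTopology (Fin d → Fin d → ℂ))
  obtain ⟨p, hp, φ, hφ, hlim⟩ := hK.tendsto_subseq (x := r) fun k => hδ k
  have hl1 : Filter.Tendsto (fun k => (r (φ k)).1) Filter.atTop (nhds p.1) :=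
    (continuous_fst.tendsto _).comp hlim
  have hl2 : Filter.Tendsto (fun k => (r (φ k)).2) Filter.atTop (nhds p.2) :=
    (continuous_snd.tendsto _).comp hlim
  refine ⟨p, ⟨?_, ?_, ?_, ?_, fun i j hij x y => ?_⟩, hp⟩
  · refine tendsto_nhds_unique (((continuous_id.matrix_conjTranspose).tendsto _).comp hl1) ?_
    simpa only [Function.comp_def, id, (hr _).herm_fst] using hl1
  · refine tendsto_nhds_unique (((continuous_id.matrix_conjTranspose).tendsto _).comp hl2) ?_
    simpa only [Function.comp_def, id, (hr _).herm_snd] using hl2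
  · refine tendsto_nhds_unique (((continuous_id.matrix_trace).tendsto _).comp hl1) ?_
    simp only [Function.comp_def, id, (hr _).trace_fst, tendsto_const_nhds]
  · refine tendsto_nhds_unique (((continuous_id.matrix_trace).tendsto _).comp hl2) ?_
    simp only [Function.comp_def, id, (hr _).trace_snd, tendsto_const_nhds]
  · have hc : Continuous fun q : Matrix (Fin dA) (Fin dA) ℂ × Matrix (Fin dB) (Fin dB) ℂ =>
        ‖(R i * (q.1 ⊗ₖ q.2) * R j) x y‖ := by
      have hk : Continuous fun q : Matrix (Fin dA) (Fin dA) ℂ × Matrix (Fin dB) (Fin dB) ℂ =>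
          q.1 ⊗ₖ q.2 := continuous_matrix fun a b =>
        (continuous_fst.matrix_elem a.1 b.1).mul (continuous_snd.matrix_elem a.2 b.2)
      exact (((continuous_const.mul hk).mul continuous_const).matrix_elem x y).norm
    have hε : Filter.Tendsto (fun k => (1 / ((φ k : ℕ) + 1) : ℝ)) Filter.atTop (nhds 0) :=
      tendsto_one_div_add_atTop_nhds_zero_nat.comp hφ.tendsto_atTop
    exact le_of_tendsto_of_tendsto' ((hc.tendsto p).comp hlim) hε
      fun k => (hr (φ k)).corner i j hij x y

theorem trace_starProjection_pos {d : ℕ} {Q : Matrix (Fin d) (Fin d) ℂ} (hQ : IsStarProjection Q)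
    (h0 : Q ≠ 0) : 0 < Q.trace.re := by
  have h : Q.trace.re = wt Q := by
    rw [wt, show Qᴴ = Q from hQ.2, show Q * Q = Q from hQ.1]
  rw [h]
  exact (wt_nonneg Q).lt_of_ne fun h => h0 (wt_eq_zero h.symm)

theorem exists_pos_trace_bound {d : ℕ} {Q : Fin n → Matrix (Fin d) (Fin d) ℂ}
    (hQ : ∀ i, IsStarProjection (Q i)) : ∃ μ > 0, ∃ δ > 0, ∀ a, dist a 1 ≤ δ →
      ∀ i, Q i ≠ 0 → μ ≤ (a * Q i).trace.re := by
  have h1 : ∀ᶠ μ in nhdsWithin (0 : ℝ) (Set.Ioi 0), ∀ i, Q i ≠ 0 → μ < (Q i).trace.re := by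
    refine Filter.eventually_all.mpr fun i => ?_
    by_cases h : Q i = 0
    · simp [h]
    · filter_upwards [nhdsWithin_le_nhds (eventually_lt_nhds (trace_starProjection_pos (hQ i) h))]
        with μ hμ _ using hμ
  obtain ⟨μ, hμ, hμ0⟩ := (h1.and self_mem_nhdsWithin).exists
  have h2 : ∀ᶠ a in nhds (1 : Matrix (Fin d) (Fin d) ℂ), ∀ i, Q i ≠ 0 →
      μ < (a * Q i).trace.re := by
    refine Filter.eventually_all.mpr fun i => ?_
    by_cases h : Q i = 0
    · simp [h]
    · have hc : Continuous fun X : Matrix (Fin d) (Fin d) ℂ => (X * Q i).trace.re :=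
        Complex.continuous_re.comp (Continuous.matrix_trace (by fun_prop))
      filter_upwards [hc.continuousAt.eventually (lt_mem_nhds (by simpa using hμ i h))]
        with a ha _ using ha
  obtain ⟨δ, hδ, hball⟩ := Metric.eventually_nhds_iff.mp h2
  -- Halving the radius fits a closed ball into the open one.
  exact ⟨μ, hμ0, δ / 2, half_pos hδ, fun a ha i hi =>
    (hball (ha.trans_lt (half_lt_self hδ)) i hi).le⟩

/-- A product projective measurement in asymptotic LOCC with at least two nonzero effects commutes
with some product operator that is close to the identity but not a multiple of it. -/
theorem exists_commuting {PA : Fin n → Matrix (Fin dA) (Fin dA) ℂ}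
    {PB : Fin n → Matrix (Fin dB) (Fin dB) ℂ} (hPA : ∀ i, IsStarProjection (PA i))
    (hPB : ∀ i, IsStarProjection (PB i)) (hR : ∀ i, IsStarProjection (PA i ⊗ₖ PB i))
    (hort : ∀ i j, i ≠ j → (PA i ⊗ₖ PB i) * (PA j ⊗ₖ PB j) = 0)
    (hlim : IsAsymptoticLOCC fun i => PA i ⊗ₖ PB i)
    (htwo : ∀ o, ∃ i, i ≠ o ∧ PA i ≠ 0 ∧ PB i ≠ 0) (hdA : 0 < dA) (hdB : 0 < dB) :
    ∃ r, AlmostCommutes (fun i => PA i ⊗ₖ PB i) 0 r ∧ r ≠ 1 ∧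
      ∀ i, (PA i ≠ 0 → (r.1 * PA i).trace ≠ 0) ∧ (PB i ≠ 0 → (r.2 * PB i).trace ≠ 0) := by
  obtain ⟨μA, hμA, δA, hδA, hA⟩ := exists_pos_trace_bound hPA
  obtain ⟨μB, hμB, δB, hδB, hB⟩ := exists_pos_trace_bound hPB
  have hδ : 0 < min δA δB := lt_min hδA hδB
  have hdA' : (0 : ℝ) < dA := by exact_mod_cast hdA
  have hdB' : (0 : ℝ) < dB := by exact_mod_cast hdB
  have key : ∀ ε > 0, ∃ r, AlmostCommutes (fun i => PA i ⊗ₖ PB i) ε r ∧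
      dist r 1 = min δA δB := by
    intro ε hε
    by_contra! hne
    -- Chosen so that the tolerance `2 * s * (dA * dB)` is exactly `ε`.
    set s : ℝ := ε / (2 * (dA * dB)) with hs
    have hs0 : 0 < s := by positivity
    have hsε : 2 * s * (dA * dB) = ε := by rw [hs]; field_simp
    -- The first bound serves nodes of large loss, the second serves leaves near the identity.
    set κ : ℝ := min (s ^ 2) (μA * μB / (dA * dB)) with hκ
    have hκ0 : 0 < κ := lt_min (by positivity) (by positivity)
    have hbound : ∀ P : Protocol n dA dB, κ * (dA * dB) ≤ loss (fun i => PA i ⊗ₖ PB i) P 1 1 := by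
      intro P
      have := le_loss_of_forall_dist_ne (δ := min δA δB) hR hs0 (κ := κ) (min_le_left _ _) ?_
        (by rw [hsε]; exact hne) P 1 1 (by rwa [wt_one]) (by rwa [wt_one])
        (by rw [normalized_one hdA, normalized_one hdB, ← Prod.one_eq_mk, dist_self]; exact hδ.le)
      · rwa [wt_one, wt_one] at this
      intro dA' dB' A B o hwA hwB hnear
      obtain ⟨i, hio, hiA, hiB⟩ := htwo o
      refine le_trans ?_ (single_wt_le_loss hR hio A B)
      rw [Prod.dist_eq] at hnear
      have h1 := hA (normalized A) ((le_max_left _ _).trans (hnear.trans (min_le_left _ _))) i hiA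
      have h2 := hB (normalized B) ((le_max_right _ _).trans (hnear.trans (min_le_right _ _))) i hiB
      rw [← Matrix.mul_kronecker_mul, wt_kronecker, wt_mul_eq_trace_normalized hwA hdA (hPA i),
        wt_mul_eq_trace_normalized hwB hdB (hPB i)]
      calc κ * (wt A * wt B) ≤ μA * μB / (dA * dB) * (wt A * wt B) := by
            gcongr; exact min_le_right _ _
        _ = (wt A / dA * μA) * (wt B / dB * μB) := by field_simp
        _ ≤ _ := by
            have := hμA.le.trans h1
            gcongr
    obtain ⟨P, hP⟩ := hlim
    have hl := tendsto_loss (R := fun i => PA i ⊗ₖ PB i) hP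
    -- The limiting measurement itself makes no error, by orthogonality.
    have h0 : (∑ o, ∑ i ∈ Finset.univ.erase o,
        ((PA o ⊗ₖ PB o) * (PA i ⊗ₖ PB i)).trace.re) = 0 :=
      Finset.sum_eq_zero fun o _ => Finset.sum_eq_zero fun i hi => by
        rw [hort o i (Finset.ne_of_mem_erase hi).symm]; simp
    rw [h0] at hl
    have := ge_of_tendsto' hl fun t => hbound (P t)
    have : 0 < κ * (dA * dB) := by positivity
    linarith
  obtain ⟨r, hr, hrδ⟩ := exists_commuting_of_forall_almostCommutes key
  refine ⟨r, hr, fun h => ?_, fun i => ⟨fun hi h => ?_, fun hi h => ?_⟩⟩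
  · rw [h, dist_self] at hrδ; exact hδ.ne hrδ
  · have := hA r.1 ((le_max_left _ _).trans (hrδ.le.trans (min_le_left _ _))) i hi
    rw [h] at this; exact absurd hμA (not_lt.mpr this)
  · have := hB r.2 ((le_max_right _ _).trans (hrδ.le.trans (min_le_right _ _))) i hi
    rw [h] at this; exact absurd hμB (not_lt.mpr this)

end Commuting

/-! ### Local splitting and induction on the dimensions. -/

section Splitting

theorem commute_of_corners_eq_zero {ι κ : Type*} [Fintype ι] [DecidableEq ι] [Fintype κ]
    [DecidableEq κ] {R : κ → Matrix ι ι ℂ} {E : Matrix ι ι ℂ} (hE : Eᴴ = E)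
    (hR : ∀ i, (R i)ᴴ = R i) (hsum : ∑ i, R i = 1)
    (hc : ∀ i j, i ≠ j → R i * E * R j = 0) (j : κ) : E * R j = R j * E := by
  have h : E * R j = R j * E * R j := by
    calc E * R j = (∑ i, R i) * E * R j := by rw [hsum, Matrix.one_mul]
      _ = ∑ i, R i * E * R j := by simp only [Matrix.sum_mul]
      _ = _ := Finset.sum_eq_single j (fun i _ hi => hc i j hi) (by simp)
  have h' := congrArg Matrix.conjTranspose h
  simp only [Matrix.conjTranspose_mul, hE, hR] at h'
  rw [h', ← Matrix.mul_assoc, ← h]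

/-- Partial trace over the second factor. -/
theorem trace_smul_left_of_kronecker_eq {ι κ : Type*} [Fintype ι] [Fintype κ]
    {X X' : Matrix ι ι ℂ} {Y Y' : Matrix κ κ ℂ} (h : X ⊗ₖ Y = X' ⊗ₖ Y') :
    Y.trace • X = Y'.trace • X' := by
  ext i j
  have := fun k => congrFun (congrFun h (i, k)) (j, k)
  simp only [Matrix.kroneckerMap_apply] at this
  simp only [Matrix.smul_apply, smul_eq_mul, Matrix.trace, Matrix.diag, Finset.sum_mul]
  exact Finset.sum_congr rfl fun k _ => by rw [mul_comm, this, mul_comm]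

theorem trace_smul_right_of_kronecker_eq {ι κ : Type*} [Fintype ι] [Fintype κ]
    {X X' : Matrix ι ι ℂ} {Y Y' : Matrix κ κ ℂ} (h : X ⊗ₖ Y = X' ⊗ₖ Y') :
    X.trace • Y = X'.trace • Y' := by
  ext i j
  have := fun k => congrFun (congrFun h (k, i)) (k, j)
  simp only [Matrix.kroneckerMap_apply] at this
  simp only [Matrix.smul_apply, smul_eq_mul, Matrix.trace, Matrix.diag, Finset.sum_mul]
  exact Finset.sum_congr rfl fun k _ => by rw [this]

/-- A Hermitian matrix that is not a multiple of the identity splits the space into two proper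
subspaces, given by isometries, that are invariant under everything it commutes with. -/
theorem exists_invariant_splitting {d : ℕ} {a : Matrix (Fin d) (Fin d) ℂ} (ha : aᴴ = a)
    (htr : a.trace = d) (h1 : a ≠ 1) :
    ∃ (r : Fin 2 → ℕ) (V : ∀ j, Matrix (Fin d) (Fin (r j)) ℂ), (∀ j, r j < d) ∧
      (∀ j, (V j)ᴴ * V j = 1) ∧ ∑ j, V j * (V j)ᴴ = 1 ∧
      ∀ P, a * P = P * a → ∀ j, V j * ((V j)ᴴ * P * V j) = P * V j := by
  have hH : a.IsHermitian := ha
  obtain ⟨U, D, hUU, hUU', haU⟩ : ∃ (U : Matrix (Fin d) (Fin d) ℂ) (D : Fin d → ℂ),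
      Uᴴ * U = 1 ∧ U * Uᴴ = 1 ∧ a = U * Matrix.diagonal D * Uᴴ :=
    ⟨hH.eigenvectorUnitary, _, Unitary.coe_star_mul_self _, Unitary.coe_mul_star_self _, by
      have := hH.spectral_theorem
      rwa [Unitary.conjStarAlgAut_apply] at this⟩
  obtain ⟨k, l, hkl⟩ : ∃ k l, D k ≠ D l := by
    -- With a single eigenvalue the matrix would be scalar, and its trace would make it the
    -- identity.
    by_contra! h
    rcases Nat.eq_zero_or_pos d with rfl | hd
    · exact h1 (Subsingleton.elim _ _)
    have hD : Matrix.diagonal D = D ⟨0, hd⟩ • (1 : Matrix (Fin d) (Fin d) ℂ) := by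
      rw [Matrix.smul_one_eq_diagonal]
      exact congrArg _ (funext fun k => h _ _)
    have hd' : (d : ℂ) ≠ 0 := by exact_mod_cast hd.ne'
    rw [hD, Matrix.mul_smul, Matrix.mul_one, Matrix.smul_mul, hUU'] at haU
    rw [haU, Matrix.trace_smul, Matrix.trace_one, Fintype.card_fin, smul_eq_mul,
      mul_eq_right₀ hd'] at htr
    exact h1 (by rw [haU, htr, one_smul])
  classical
  -- One block is the eigenspace of `D k`, the other its orthogonal complement. Both are nonzero,
  -- hence both are proper.
  set f : Fin d → Fin 2 := fun m => if D m = D k then 0 else 1 with hf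
  have hfD : ∀ x y, f x ≠ f y → D x ≠ D y := fun x y h h' => h (by simp [hf, h'])
  let e : ∀ j, Fin (Fintype.card {m // f m = j}) ≃ {m // f m = j} := fun j =>
    (Fintype.equivFin _).symm
  let V : ∀ j, Matrix (Fin d) (Fin (Fintype.card {m // f m = j})) ℂ := fun j =>
    U.submatrix id fun x => (e j x : Fin d)
  have hVV : ∑ j, V j * (V j)ᴴ = 1 := by
    rw [← hUU']
    ext x y
    rw [Matrix.sum_apply, Matrix.mul_apply, ← Fintype.sum_fiberwise f]
    refine Finset.sum_congr rfl fun j _ => ?_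
    rw [Matrix.mul_apply, ← (e j).sum_comp]
    rfl
  refine ⟨fun j => Fintype.card {m // f m = j}, V, fun j => ?_, fun j => ?_, hVV,
    fun P hP j => ?_⟩
  · have : ∃ x, ¬ f x = j := by
      by_contra! h
      exact hkl (by simpa [hf, eq_comm] using (h l).trans (h k).symm)
    obtain ⟨x, hx⟩ := this
    exact (Fintype.card_subtype_lt (p := fun m => f m = j) hx).trans_eq (Fintype.card_fin d)
  · ext x y
    have : ((V j)ᴴ * V j) x y = (Uᴴ * U) (e j x) (e j y) := rfl
    rw [this, hUU, Matrix.one_apply, Matrix.one_apply]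
    simp [Subtype.val_inj]
  -- In an eigenbasis of `a`, commuting matrices have no entries between different eigenvalues.
  · have hN : ∀ x y, f x ≠ f y → (Uᴴ * P * U) x y = 0 := by
      intro x y hxy
      have hcomm : Matrix.diagonal D * (Uᴴ * P * U) = (Uᴴ * P * U) * Matrix.diagonal D := by
        calc _ = (Uᴴ * U) * Matrix.diagonal D * Uᴴ * P * U := by
              rw [hUU, Matrix.one_mul]; simp only [Matrix.mul_assoc]
          _ = Uᴴ * (a * P) * U := by rw [haU]; simp only [Matrix.mul_assoc]
          _ = Uᴴ * P * U * Matrix.diagonal D * (Uᴴ * U) := by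
              rw [hP, haU]; simp only [Matrix.mul_assoc]
          _ = _ := by rw [hUU, Matrix.mul_one]
      have := congrFun (congrFun hcomm x) y
      rw [Matrix.diagonal_mul, Matrix.mul_diagonal, mul_comm, ← sub_eq_zero, ← mul_sub] at this
      exact (mul_eq_zero.mp this).resolve_right (sub_ne_zero.mpr (hfD x y hxy))
    have hoff : ∀ i, i ≠ j → (V i)ᴴ * P * V j = 0 := by
      intro i hij
      ext x y
      have : ((V i)ᴴ * P * V j) x y = (Uᴴ * P * U) (e i x) (e j y) := rfl
      rw [this, hN _ _ (by rw [(e i x).2, (e j y).2]; exact hij), Matrix.zero_apply]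
    calc V j * ((V j)ᴴ * P * V j) = ∑ i, V i * ((V i)ᴴ * P * V j) :=
          (Finset.sum_eq_single (f := fun i => V i * ((V i)ᴴ * P * V j)) j (fun i _ hi => by
            simp only [hoff i hi, Matrix.mul_zero]) fun h => absurd (Finset.mem_univ j) h).symm
      _ = (∑ i, V i * (V i)ᴴ) * (P * V j) := by simp only [Matrix.sum_mul, Matrix.mul_assoc]
      _ = _ := by rw [hVV, Matrix.one_mul]

/-- Invariance `hV` makes compression by `V` multiplicative on `P`. -/
theorem isStarProjection_compression {ι κ : Type*} [Fintype ι] [Fintype κ] {V : Matrix ι κ ℂ}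
    {P : Matrix ι ι ℂ} (hP : IsStarProjection P) (hV : V * (Vᴴ * P * V) = P * V) :
    IsStarProjection (Vᴴ * P * V) := by
  refine ⟨?_, ?_⟩
  · change Vᴴ * P * V * (Vᴴ * P * V) = Vᴴ * P * V
    rw [Matrix.mul_assoc (Vᴴ * P) V, hV, ← Matrix.mul_assoc, Matrix.mul_assoc Vᴴ P P,
      show P * P = P from hP.1]
  · change (Vᴴ * P * V)ᴴ = Vᴴ * P * V
    rw [Matrix.conjTranspose_mul, Matrix.conjTranspose_mul, Matrix.conjTranspose_conjTranspose,
      show Pᴴ = P from hP.2, Matrix.mul_assoc]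

theorem IsProjectiveMeasurement.compression {dA' dB' : ℕ} {M : Fin n → BipOp dA dB}
    (hM : IsProjectiveMeasurement M) {W : Matrix (Fin dA × Fin dB) (Fin dA' × Fin dB') ℂ}
    (hW : Wᴴ * W = 1) (hWM : ∀ i, W * (Wᴴ * M i * W) = M i * W) :
    IsProjectiveMeasurement fun i => Wᴴ * M i * W where
  isProj i := isStarProjection_compression (hM.isProj i) (hWM i)
  orthogonal i j hij := by
    rw [Matrix.mul_assoc (Wᴴ * M i) W, hWM, ← Matrix.mul_assoc, Matrix.mul_assoc Wᴴ,
      hM.orthogonal i j hij, Matrix.mul_zero, Matrix.zero_mul]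
  sum_eq_one := by
    rw [← Matrix.sum_mul, ← Matrix.mul_sum, hM.sum_eq_one, Matrix.mul_one, hW]

/-- The application of an isometry. -/
def Instrument.ofIsometry {d e : ℕ} (V : Matrix (Fin d) (Fin e) ℂ) (hV : Vᴴ * V = 1) :
    Instrument e where
  outcomes := 1
  outDim _ := d
  krausCount _ := 1
  K _ _ := V
  trace_preserving := by simpa using hV

/-- The projective measurement onto the ranges of the isometries `V j`. -/
def Instrument.ofSplitting {d m : ℕ} {r : Fin m → ℕ} (V : ∀ j, Matrix (Fin d) (Fin (r j)) ℂ)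
    (hV : ∑ j, V j * (V j)ᴴ = 1) : Instrument d where
  outcomes := m
  outDim := r
  krausCount _ := 1
  K j _ := (V j)ᴴ
  trace_preserving := by simpa using hV

theorem povm_alice_ofIsometry {d : ℕ} {V : Matrix (Fin dA) (Fin d) ℂ} (hV : Vᴴ * V = 1)
    (P : Protocol n dA dB) (i : Fin n) :
    (Protocol.alice (Instrument.ofIsometry V hV) fun _ => P).povm i =
      (V ⊗ₖ (1 : Matrix (Fin dB) (Fin dB) ℂ))ᴴ * P.povm i *
        (V ⊗ₖ (1 : Matrix (Fin dB) (Fin dB) ℂ)) :=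
  (Fin.sum_univ_one _).trans (Fin.sum_univ_one _)

/-- Alice embeds her smaller system by `V` before each protocol of the sequence. -/
theorem IsAsymptoticLOCC.alice_compression {d : ℕ} {M : Fin n → BipOp dA dB}
    (hM : IsAsymptoticLOCC M) {V : Matrix (Fin dA) (Fin d) ℂ} (hV : Vᴴ * V = 1) :
    IsAsymptoticLOCC fun i => (V ⊗ₖ (1 : Matrix (Fin dB) (Fin dB) ℂ))ᴴ * M i *
      (V ⊗ₖ (1 : Matrix (Fin dB) (Fin dB) ℂ)) := by
  obtain ⟨P, hP⟩ := hM
  refine ⟨fun t => .alice (Instrument.ofIsometry V hV) fun _ => P t, tendsto_pi_nhds.mpr fun i => ?_⟩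
  have hc : Continuous fun X : BipOp dA dB => (V ⊗ₖ (1 : Matrix (Fin dB) (Fin dB) ℂ))ᴴ * X *
      (V ⊗ₖ (1 : Matrix (Fin dB) (Fin dB) ℂ)) :=
    (continuous_const.matrix_mul continuous_id).matrix_mul continuous_const
  simpa only [povm_alice_ofIsometry, Function.comp_def] using
    (hc.tendsto _).comp (tendsto_pi_nhds.mp hP i)

theorem povm_bob_ofIsometry {d : ℕ} {V : Matrix (Fin dB) (Fin d) ℂ} (hV : Vᴴ * V = 1)
    (P : Protocol n dA dB) (i : Fin n) :
    (Protocol.bob (Instrument.ofIsometry V hV) fun _ => P).povm i =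
      ((1 : Matrix (Fin dA) (Fin dA) ℂ) ⊗ₖ V)ᴴ * P.povm i *
        ((1 : Matrix (Fin dA) (Fin dA) ℂ) ⊗ₖ V) :=
  (Fin.sum_univ_one _).trans (Fin.sum_univ_one _)

theorem IsAsymptoticLOCC.bob_compression {d : ℕ} {M : Fin n → BipOp dA dB}
    (hM : IsAsymptoticLOCC M) {V : Matrix (Fin dB) (Fin d) ℂ} (hV : Vᴴ * V = 1) :
    IsAsymptoticLOCC fun i => ((1 : Matrix (Fin dA) (Fin dA) ℂ) ⊗ₖ V)ᴴ * M i *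
      ((1 : Matrix (Fin dA) (Fin dA) ℂ) ⊗ₖ V) := by
  obtain ⟨P, hP⟩ := hM
  refine ⟨fun t => .bob (Instrument.ofIsometry V hV) fun _ => P t, tendsto_pi_nhds.mpr fun i => ?_⟩
  have hc : Continuous fun X : BipOp dA dB => ((1 : Matrix (Fin dA) (Fin dA) ℂ) ⊗ₖ V)ᴴ * X *
      ((1 : Matrix (Fin dA) (Fin dA) ℂ) ⊗ₖ V) :=
    (continuous_const.matrix_mul continuous_id).matrix_mul continuous_const
  simpa only [povm_bob_ofIsometry, Function.comp_def] using
    (hc.tendsto _).comp (tendsto_pi_nhds.mp hP i)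

variable {PA : Fin n → Matrix (Fin dA) (Fin dA) ℂ} {PB : Fin n → Matrix (Fin dB) (Fin dB) ℂ}

/-- Product projective measurements on `ℂ^dA ⊗ ℂ^dB` in asymptotic LOCC are in finite LOCC. -/
def AsymptoticSuffices (n dA dB : ℕ) : Prop :=
  ∀ (PA : Fin n → Matrix (Fin dA) (Fin dA) ℂ) (PB : Fin n → Matrix (Fin dB) (Fin dB) ℂ),
    (∀ i, IsStarProjection (PA i)) → (∀ i, IsStarProjection (PB i)) →
    IsProjectiveMeasurement (fun i => PA i ⊗ₖ PB i) →
    IsAsymptoticLOCC (fun i => PA i ⊗ₖ PB i) → IsFiniteLOCC (fun i => PA i ⊗ₖ PB i)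

/-- Alice measures the block `j`, then a finite protocol for the compressed measurement is run. By
invariance block `j` contributes `PA i * (V j * (V j)ᴴ)` to Alice's factor, and these add up to `PA
i`. -/
theorem isFiniteLOCC_of_alice_splitting (hPA : ∀ i, IsStarProjection (PA i))
    (hPB : ∀ i, IsStarProjection (PB i)) (hM : IsProjectiveMeasurement fun i => PA i ⊗ₖ PB i)
    (hlim : IsAsymptoticLOCC fun i => PA i ⊗ₖ PB i) {m : ℕ} {r : Fin m → ℕ}
    {V : ∀ j, Matrix (Fin dA) (Fin (r j)) ℂ} (hV : ∀ j, (V j)ᴴ * V j = 1)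
    (hsum : ∑ j, V j * (V j)ᴴ = 1)
    (hinv : ∀ i j, V j * ((V j)ᴴ * PA i * V j) = PA i * V j)
    (ih : ∀ j, AsymptoticSuffices n (r j) dB) : IsFiniteLOCC fun i => PA i ⊗ₖ PB i := by
  have hk : ∀ i j, ((V j)ᴴ * PA i * V j) ⊗ₖ PB i = (V j ⊗ₖ (1 : Matrix (Fin dB) (Fin dB) ℂ))ᴴ *
      (PA i ⊗ₖ PB i) * (V j ⊗ₖ (1 : Matrix (Fin dB) (Fin dB) ℂ)) := fun i j => by
    rw [Matrix.conjTranspose_kronecker, ← Matrix.mul_kronecker_mul, ← Matrix.mul_kronecker_mul,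
      Matrix.conjTranspose_one, Matrix.one_mul, Matrix.mul_one]
  have hfin : ∀ j, IsFiniteLOCC fun i => ((V j)ᴴ * PA i * V j) ⊗ₖ PB i := by
    intro j
    refine ih j _ _ (fun i => isStarProjection_compression (hPA i) (hinv i j)) hPB ?_ ?_
    · simp only [hk]
      refine hM.compression ?_ fun i => ?_
      · rw [Matrix.conjTranspose_kronecker, ← Matrix.mul_kronecker_mul, hV,
          Matrix.conjTranspose_one, Matrix.one_mul, Matrix.one_kronecker_one]
      · rw [← hk, ← Matrix.mul_kronecker_mul, ← Matrix.mul_kronecker_mul, hinv, Matrix.one_mul,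
          Matrix.mul_one]
    · simp only [hk]
      exact hlim.alice_compression (hV j)
  choose P hP using hfin
  refine ⟨.alice (Instrument.ofSplitting V hsum) P, funext fun i => ?_⟩
  calc _ = ∑ j, ((V j)ᴴ ⊗ₖ (1 : Matrix (Fin dB) (Fin dB) ℂ))ᴴ * (P j).povm i *
        ((V j)ᴴ ⊗ₖ (1 : Matrix (Fin dB) (Fin dB) ℂ)) :=
        Finset.sum_congr rfl fun j _ => Fin.sum_univ_one _
    _ = ∑ j, (PA i * (V j * (V j)ᴴ)) ⊗ₖ PB i := by
        refine Finset.sum_congr rfl fun j _ => ?_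
        rw [hP j, Matrix.conjTranspose_kronecker, ← Matrix.mul_kronecker_mul,
          ← Matrix.mul_kronecker_mul, Matrix.conjTranspose_conjTranspose, hinv,
          Matrix.conjTranspose_one, Matrix.one_mul, Matrix.mul_one, Matrix.mul_assoc]
    _ = (PA i * ∑ j, V j * (V j)ᴴ) ⊗ₖ PB i := by
        ext; simp [Matrix.mul_sum, Matrix.sum_apply, Finset.sum_mul]
    _ = _ := by rw [hsum, Matrix.mul_one]

theorem isFiniteLOCC_of_bob_splitting (hPA : ∀ i, IsStarProjection (PA i))
    (hPB : ∀ i, IsStarProjection (PB i)) (hM : IsProjectiveMeasurement fun i => PA i ⊗ₖ PB i)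
    (hlim : IsAsymptoticLOCC fun i => PA i ⊗ₖ PB i) {m : ℕ} {r : Fin m → ℕ}
    {V : ∀ j, Matrix (Fin dB) (Fin (r j)) ℂ} (hV : ∀ j, (V j)ᴴ * V j = 1)
    (hsum : ∑ j, V j * (V j)ᴴ = 1)
    (hinv : ∀ i j, V j * ((V j)ᴴ * PB i * V j) = PB i * V j)
    (ih : ∀ j, AsymptoticSuffices n dA (r j)) : IsFiniteLOCC fun i => PA i ⊗ₖ PB i := by
  have hk : ∀ i j, PA i ⊗ₖ ((V j)ᴴ * PB i * V j) = ((1 : Matrix (Fin dA) (Fin dA) ℂ) ⊗ₖ V j)ᴴ *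
      (PA i ⊗ₖ PB i) * ((1 : Matrix (Fin dA) (Fin dA) ℂ) ⊗ₖ V j) := fun i j => by
    rw [Matrix.conjTranspose_kronecker, ← Matrix.mul_kronecker_mul, ← Matrix.mul_kronecker_mul,
      Matrix.conjTranspose_one, Matrix.one_mul, Matrix.mul_one]
  have hfin : ∀ j, IsFiniteLOCC fun i => PA i ⊗ₖ ((V j)ᴴ * PB i * V j) := by
    intro j
    refine ih j _ _ hPA (fun i => isStarProjection_compression (hPB i) (hinv i j)) ?_ ?_
    · simp only [hk]
      refine hM.compression ?_ fun i => ?_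
      · rw [Matrix.conjTranspose_kronecker, ← Matrix.mul_kronecker_mul, hV,
          Matrix.conjTranspose_one, Matrix.one_mul, Matrix.one_kronecker_one]
      · rw [← hk, ← Matrix.mul_kronecker_mul, ← Matrix.mul_kronecker_mul, hinv, Matrix.one_mul,
          Matrix.mul_one]
    · simp only [hk]
      exact hlim.bob_compression (hV j)
  choose P hP using hfin
  refine ⟨.bob (Instrument.ofSplitting V hsum) P, funext fun i => ?_⟩
  calc _ = ∑ j, ((1 : Matrix (Fin dA) (Fin dA) ℂ) ⊗ₖ (V j)ᴴ)ᴴ * (P j).povm i *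
        ((1 : Matrix (Fin dA) (Fin dA) ℂ) ⊗ₖ (V j)ᴴ) :=
        Finset.sum_congr rfl fun j _ => Fin.sum_univ_one _
    _ = ∑ j, PA i ⊗ₖ (PB i * (V j * (V j)ᴴ)) := by
        refine Finset.sum_congr rfl fun j _ => ?_
        rw [hP j, Matrix.conjTranspose_kronecker, ← Matrix.mul_kronecker_mul,
          ← Matrix.mul_kronecker_mul, Matrix.conjTranspose_conjTranspose, hinv,
          Matrix.conjTranspose_one, Matrix.one_mul, Matrix.mul_one, Matrix.mul_assoc]
    _ = PA i ⊗ₖ (PB i * ∑ j, V j * (V j)ᴴ) := by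
        ext; simp [Matrix.sum_apply, Finset.mul_sum]
    _ = _ := by rw [hsum, Matrix.mul_one]

theorem IsProjectiveMeasurement.exists_ne {M : Fin n → BipOp dA dB}
    (hM : IsProjectiveMeasurement M) (hone : ∀ o, M o ≠ 1) (o : Fin n) :
    ∃ i, i ≠ o ∧ M i ≠ 0 := by
  by_contra! h
  refine hone o ?_
  rw [← hM.sum_eq_one]
  exact (Finset.sum_eq_single o (fun i _ hi => h i hi) (by simp)).symm

theorem kronecker_ne_zero_iff {ι κ : Type*} {X : Matrix ι ι ℂ} {Y : Matrix κ κ ℂ} :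
    X ⊗ₖ Y ≠ 0 ↔ X ≠ 0 ∧ Y ≠ 0 := by
  constructor
  · refine fun h => ⟨fun h' => h ?_, fun h' => h ?_⟩ <;> simp [h']
  · rintro ⟨hX, hY⟩ h
    obtain ⟨i, j, hij⟩ : ∃ i j, X i j ≠ 0 := by
      by_contra! h'; exact hX (by ext i j; exact h' i j)
    refine hY ?_
    ext k l
    exact (mul_eq_zero.mp (congrFun (congrFun h (i, k)) (j, l))).resolve_left hij

theorem asymptoticSuffices (n dA dB : ℕ) : AsymptoticSuffices n dA dB := by
  induction hN : dA + dB using Nat.strong_induction_on generalizing dA dB with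
  | _ N ih =>
  intro PA PB hPA hPB hM hlim
  -- In dimension zero all measurements coincide, and the hypothesis supplies a protocol.
  rcases Nat.eq_zero_or_pos dA with rfl | hdA
  · obtain ⟨P, -⟩ := hlim
    exact ⟨P 0, Subsingleton.elim _ _⟩
  rcases Nat.eq_zero_or_pos dB with rfl | hdB
  · obtain ⟨P, -⟩ := hlim
    exact ⟨P 0, Subsingleton.elim _ _⟩
  by_cases hone : ∃ o, PA o ⊗ₖ PB o = 1
  · obtain ⟨o, ho⟩ := hone
    refine ⟨.output o, funext fun i => ?_⟩
    by_cases hi : i = o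
    · simp only [Protocol.povm, hi, ho, if_true]
    · simp only [Protocol.povm, if_neg hi]
      rw [← hM.orthogonal i o hi, ho, Matrix.mul_one]
  push Not at hone
  obtain ⟨r, hr, hr1, htr⟩ := exists_commuting hPA hPB hM.isProj hM.orthogonal hlim
    (fun o => (hM.exists_ne hone o).imp fun i hi => ⟨hi.1, kronecker_ne_zero_iff.mp hi.2⟩) hdA hdB
  have hcomm : ∀ i, (r.1 * PA i) ⊗ₖ (r.2 * PB i) = (PA i * r.1) ⊗ₖ (PB i * r.2) := fun i => by
    rw [Matrix.mul_kronecker_mul, Matrix.mul_kronecker_mul]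
    refine commute_of_corners_eq_zero (R := fun i => PA i ⊗ₖ PB i) ?_ (fun i => (hM.isProj i).2)
      hM.sum_eq_one (fun i j hij => ?_) i
    · rw [Matrix.conjTranspose_kronecker, hr.herm_fst, hr.herm_snd]
    · ext x y
      exact norm_le_zero_iff.mp (hr.corner i j hij x y)
  classical
  by_cases ha : r.1 = 1
  · have hb : r.2 ≠ 1 := fun hb => hr1 (Prod.ext ha hb)
    obtain ⟨d, V, hd, hV, hsum, hinv⟩ := exists_invariant_splitting hr.herm_snd hr.trace_snd hb
    -- When `PA i = 0` nothing constrains `PB i`, which need not commute with `r.2`. Replacing it by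
    -- zero leaves the product unchanged.
    have hPB' : ∀ i, PA i ⊗ₖ (if PA i = 0 then 0 else PB i) = PA i ⊗ₖ PB i := fun i => by
      split_ifs with h <;> simp [h]
    rw [← funext hPB'] at hM hlim ⊢
    refine isFiniteLOCC_of_bob_splitting hPA (fun i => ?_) hM hlim hV hsum
      (fun i j => hinv _ ?_ j) fun j => ih _ (by have := hd j; lia) dA (d j) rfl
    · split_ifs
      · exact IsStarProjection.zero _
      · exact hPB i
    · split_ifs with h
      · simp
      -- The nonzero trace of `r.1 * PA i` can be cancelled, so `r.2` commutes with `PB i`.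
      · have := trace_smul_right_of_kronecker_eq (hcomm i)
        rw [Matrix.trace_mul_comm (PA i)] at this
        exact smul_right_injective _ ((htr i).1 h) this
  · obtain ⟨d, V, hd, hV, hsum, hinv⟩ := exists_invariant_splitting hr.herm_fst hr.trace_fst ha
    have hPA' : ∀ i, (if PB i = 0 then 0 else PA i) ⊗ₖ PB i = PA i ⊗ₖ PB i := fun i => by
      split_ifs with h <;> simp [h]
    rw [← funext hPA'] at hM hlim ⊢
    refine isFiniteLOCC_of_alice_splitting (fun i => ?_) hPB hM hlim hV hsum
      (fun i j => hinv _ ?_ j) fun j => ih _ (by have := hd j; lia) (d j) dB rfl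
    · split_ifs
      · exact IsStarProjection.zero _
      · exact hPA i
    · split_ifs with h
      · simp
      · have := trace_smul_left_of_kronecker_eq (hcomm i)
        rw [Matrix.trace_mul_comm (PB i)] at this
        exact smul_right_injective _ ((htr i).2 h) this

end Splitting

/-! ### Discriminating measurements of full orthogonal sets. -/

section Discrimination

theorem Protocol.povm_posSemidef (P : Protocol n dA dB) (i : Fin n) : (P.povm i).PosSemidef := by
  induction P with
  | output o =>
    simp only [Protocol.povm]
    split_ifs
    · exact .one
    · exact .zero
  | alice J next ih =>
    exact Matrix.posSemidef_sum _ fun j _ => Matrix.posSemidef_sum _ fun k _ =>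
      (ih j).conjTranspose_mul_mul_same _
  | bob J next ih =>
    exact Matrix.posSemidef_sum _ fun j _ => Matrix.posSemidef_sum _ fun k _ =>
      (ih j).conjTranspose_mul_mul_same _

theorem Protocol.sum_povm (P : Protocol n dA dB) : ∑ i, P.povm i = 1 := by
  induction P with
  | output o => simp [Protocol.povm]
  | @alice dA dB J next ih =>
    simp only [Protocol.povm]
    rw [Finset.sum_comm, Finset.sum_congr rfl fun j _ => Finset.sum_comm]
    simp only [← Matrix.sum_mul, ← Matrix.mul_sum, ih, Matrix.mul_one,
      Matrix.conjTranspose_kronecker, ← Matrix.mul_kronecker_mul, Matrix.conjTranspose_one]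
    calc _ = (∑ j, ∑ k, (J.K j k)ᴴ * J.K j k) ⊗ₖ (1 : Matrix (Fin dB) (Fin dB) ℂ) := by
          ext; simp [Matrix.sum_apply, Finset.sum_mul]
      _ = 1 := by rw [J.trace_preserving, Matrix.one_kronecker_one]
  | @bob dA dB J next ih =>
    simp only [Protocol.povm]
    rw [Finset.sum_comm, Finset.sum_congr rfl fun j _ => Finset.sum_comm]
    simp only [← Matrix.sum_mul, ← Matrix.mul_sum, ih, Matrix.mul_one,
      Matrix.conjTranspose_kronecker, ← Matrix.mul_kronecker_mul, Matrix.conjTranspose_one]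
    calc _ = (1 : Matrix (Fin dA) (Fin dA) ℂ) ⊗ₖ (∑ j, ∑ k, (J.K j k)ᴴ * J.K j k) := by
          ext; simp [Matrix.sum_apply, Finset.mul_sum]
      _ = 1 := by rw [J.trace_preserving, Matrix.one_kronecker_one]

theorem IsAsymptoticLOCC.posSemidef {M : Fin n → BipOp dA dB} (hM : IsAsymptoticLOCC M)
    (i : Fin n) : (M i).PosSemidef := by
  obtain ⟨P, hP⟩ := hM
  have hi := tendsto_pi_nhds.mp hP i
  refine .of_dotProduct_mulVec_nonneg ?_ fun x => ?_
  · refine tendsto_nhds_unique (((continuous_id.matrix_conjTranspose).tendsto _).comp hi) ?_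
    simpa only [Function.comp_def, id, ((P _).povm_posSemidef i).isHermitian.eq] using hi
  · have hc : Continuous fun X : BipOp dA dB => star x ⬝ᵥ (X *ᵥ x) :=
      continuous_const.dotProduct (continuous_id.matrix_mulVec continuous_const)
    have := Complex.orderClosedTopology
    exact ge_of_tendsto' ((hc.tendsto _).comp hi)
      fun t => ((P t).povm_posSemidef i).dotProduct_mulVec_nonneg x

theorem IsAsymptoticLOCC.sum_eq_one {M : Fin n → BipOp dA dB} (hM : IsAsymptoticLOCC M) :
    ∑ i, M i = 1 := by
  obtain ⟨P, hP⟩ := hM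
  refine tendsto_nhds_unique (tendsto_finsetSum _ fun i _ => tendsto_pi_nhds.mp hP i) ?_
  simp only [Protocol.sum_povm, tendsto_const_nhds]

/-- For `X = Cᴴ * C` and `Y = Dᴴ * D` the trace is the squared Hilbert–Schmidt norm of `C * Dᴴ`. -/
theorem mul_eq_zero_of_trace_mul_eq_zero {ι : Type*} [Fintype ι] [DecidableEq ι]
    {X Y : Matrix ι ι ℂ} (hX : X.PosSemidef) (hY : Y.PosSemidef) (h : (X * Y).trace = 0) :
    X * Y = 0 := by
  open scoped MatrixOrder in
  obtain ⟨C, rfl⟩ := CStarAlgebra.nonneg_iff_eq_star_mul_self.mp hX.nonneg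
  open scoped MatrixOrder in
  obtain ⟨D, rfl⟩ := CStarAlgebra.nonneg_iff_eq_star_mul_self.mp hY.nonneg
  simp only [Matrix.star_eq_conjTranspose] at h ⊢
  have h0 : C * Dᴴ = 0 := by
    rw [← Matrix.trace_conjTranspose_mul_self_eq_zero_iff, Matrix.conjTranspose_mul,
      Matrix.conjTranspose_conjTranspose, ← h, Matrix.mul_assoc, Matrix.trace_mul_comm]
    simp only [Matrix.mul_assoc]
  calc Cᴴ * C * (Dᴴ * D) = Cᴴ * (C * Dᴴ) * D := by simp only [Matrix.mul_assoc]
    _ = 0 := by rw [h0, Matrix.mul_zero, Matrix.zero_mul]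

/-- The support projection of a Hermitian matrix, together with its pseudo-inverse. -/
theorem exists_support_projection {ι : Type*} [Fintype ι] [DecidableEq ι] {τ : Matrix ι ι ℂ}
    (hτ : τ.IsHermitian) :
    ∃ P X, IsStarProjection P ∧ τ * X = P ∧ X * τ = P ∧ P * τ = τ := by
  obtain ⟨U, D, hUU, haU⟩ : ∃ (U : Matrix ι ι ℂ) (D : ι → ℝ), Uᴴ * U = 1 ∧
      τ = U * Matrix.diagonal (fun i => (D i : ℂ)) * Uᴴ :=
    ⟨hτ.eigenvectorUnitary, hτ.eigenvalues, Unitary.coe_star_mul_self _, by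
      have := hτ.spectral_theorem
      rwa [Unitary.conjStarAlgAut_apply] at this⟩
  have hmul : ∀ D E : ι → ℂ, U * Matrix.diagonal D * Uᴴ * (U * Matrix.diagonal E * Uᴴ) =
      U * Matrix.diagonal (fun i => D i * E i) * Uᴴ := fun D E => by
    calc _ = U * Matrix.diagonal D * (Uᴴ * U) * Matrix.diagonal E * Uᴴ := by
          simp only [Matrix.mul_assoc]
      _ = _ := by rw [hUU, Matrix.mul_one, Matrix.mul_assoc U, Matrix.diagonal_mul_diagonal]
  refine ⟨U * Matrix.diagonal (fun i => (D i : ℂ) * (D i : ℂ)⁻¹) * Uᴴ,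
    U * Matrix.diagonal (fun i => (D i : ℂ)⁻¹) * Uᴴ, ⟨?_, ?_⟩, ?_, ?_, ?_⟩
  · rw [IsIdempotentElem, hmul]
    congr 3
    ext i
    by_cases h : (D i : ℂ) = 0 <;> simp [h]
  · change (_ : Matrix ι ι ℂ)ᴴ = _
    simp only [Matrix.conjTranspose_mul, Matrix.conjTranspose_conjTranspose,
      Matrix.diagonal_conjTranspose, Matrix.mul_assoc]
    congr 3
    ext i
    simp
  · rw [haU, hmul]
  · rw [haU, hmul]
    simp only [mul_comm]
  · rw [haU, hmul]
    congr 3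
    ext i
    by_cases h : (D i : ℂ) = 0 <;> simp [h]

theorem eq_one_of_mul_eq_of_rank {ι : Type*} [Fintype ι] [DecidableEq ι] {S T : Matrix ι ι ℂ}
    (hT : T.rank = Fintype.card ι) (h : S * T = T) : S = 1 := by
  have htop : LinearMap.range T.mulVecLin = ⊤ :=
    Submodule.eq_top_of_finrank_eq (by rw [Module.finrank_fintype_fun_eq_card]; exact hT)
  refine Matrix.ext_of_mulVec_single fun i => ?_
  obtain ⟨y, hy⟩ := LinearMap.range_eq_top.mp htop (Pi.single i 1)
  rw [← hy, Matrix.mulVecLin_apply, Matrix.mulVec_mulVec, h, Matrix.one_mulVec]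

/-- Only the measurement of the supports discriminates a full orthogonal set. -/
theorem exists_projective_of_discriminates {τ : Fin n → Matrix (Fin dA) (Fin dA) ℂ}
    {σ : Fin n → Matrix (Fin dB) (Fin dB) ℂ} (hτ : ∀ i, IsState (τ i)) (hσ : ∀ i, IsState (σ i))
    (hρ : IsFullOrthogonalSet fun i => τ i ⊗ₖ σ i) {M : Fin n → BipOp dA dB}
    (hM : ∀ i, (M i).PosSemidef) (hsum : ∑ i, M i = 1)
    (hd : Discriminates M fun i => τ i ⊗ₖ σ i) :
    ∃ (PA : Fin n → Matrix (Fin dA) (Fin dA) ℂ) (PB : Fin n → Matrix (Fin dB) (Fin dB) ℂ),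
      (∀ i, IsStarProjection (PA i)) ∧ (∀ i, IsStarProjection (PB i)) ∧
      IsProjectiveMeasurement (fun i => PA i ⊗ₖ PB i) ∧ M = fun i => PA i ⊗ₖ PB i := by
  choose PA XA hPA hPA₁ hPA₂ hPA₃ using fun i => exists_support_projection (hτ i).1.isHermitian
  choose PB XB hPB hPB₁ hPB₂ hPB₃ using fun i => exists_support_projection (hσ i).1.isHermitian
  have h₁ : ∀ i, (τ i ⊗ₖ σ i) * (XA i ⊗ₖ XB i) = PA i ⊗ₖ PB i := fun i => by
    rw [← Matrix.mul_kronecker_mul, hPA₁, hPB₁]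
  have h₂ : ∀ i, (XA i ⊗ₖ XB i) * (τ i ⊗ₖ σ i) = PA i ⊗ₖ PB i := fun i => by
    rw [← Matrix.mul_kronecker_mul, hPA₂, hPB₂]
  have h₃ : ∀ i, (PA i ⊗ₖ PB i) * (τ i ⊗ₖ σ i) = τ i ⊗ₖ σ i := fun i => by
    rw [← Matrix.mul_kronecker_mul, hPA₃, hPB₃]
  have hρ0 : ∀ i j, i ≠ j → (τ i ⊗ₖ σ i) * (τ j ⊗ₖ σ j) = 0 := fun i j hij =>
    mul_eq_zero_of_trace_mul_eq_zero (hρ.isState i).1 (hρ.isState j).1 (hρ.orthogonal i j hij)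
  have hPρ : ∀ i j, i ≠ j → (PA i ⊗ₖ PB i) * (τ j ⊗ₖ σ j) = 0 := fun i j hij => by
    rw [← h₂, Matrix.mul_assoc, hρ0 i j hij, Matrix.mul_zero]
  -- The sum of the support projections fixes the sum of the states, which is invertible by full
  -- rank.
  have hP1 : ∑ i, PA i ⊗ₖ PB i = 1 := by
    refine eq_one_of_mul_eq_of_rank (T := ∑ j, τ j ⊗ₖ σ j) (by simpa using hρ.full_rank) ?_
    simp only [Matrix.sum_mul, Matrix.mul_sum]
    refine Finset.sum_congr rfl fun i _ => ?_
    rw [Finset.sum_eq_single i (fun j _ hj => hPρ _ _ hj) (by simp), h₃]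
  -- Zero probability means that `M i` annihilates the state `j`. The pseudo-inverse transfers this
  -- to its support.
  have hMP : ∀ i j, i ≠ j → M i * (PA j ⊗ₖ PB j) = 0 := fun i j hij => by
    rw [← h₁, ← Matrix.mul_assoc, mul_eq_zero_of_trace_mul_eq_zero (hM i) (hρ.isState j).1
      (by rw [hd i j, if_neg hij]), Matrix.zero_mul]
  refine ⟨PA, PB, hPA, hPB, ⟨fun i => ⟨?_, ?_⟩, fun i j hij => ?_, hP1⟩, funext fun i => ?_⟩
  · change (PA i ⊗ₖ PB i) * (PA i ⊗ₖ PB i) = PA i ⊗ₖ PB i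
    rw [← Matrix.mul_kronecker_mul, show PA i * PA i = PA i from (hPA i).1,
      show PB i * PB i = PB i from (hPB i).1]
  · change (PA i ⊗ₖ PB i)ᴴ = PA i ⊗ₖ PB i
    rw [Matrix.conjTranspose_kronecker, show (PA i)ᴴ = PA i from (hPA i).2,
      show (PB i)ᴴ = PB i from (hPB i).2]
  · rw [← h₁ j, ← Matrix.mul_assoc, hPρ i j hij, Matrix.zero_mul]
  · calc M i = M i * ∑ j, PA j ⊗ₖ PB j := by rw [hP1, Matrix.mul_one]
      _ = M i * (PA i ⊗ₖ PB i) := by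
        rw [Matrix.mul_sum]
        exact Finset.sum_eq_single i (fun j _ hj => hMP i j hj.symm) (by simp)
      _ = (∑ j, M j) * (PA i ⊗ₖ PB i) := by
        rw [Matrix.sum_mul]
        exact (Finset.sum_eq_single i (fun j _ hj => hMP j i hj) (by simp)).symm
      _ = PA i ⊗ₖ PB i := by rw [hsum, Matrix.one_mul]

end Discrimination

end LOCC

theorem mainTheorem1 (dA dB n : ℕ) :
    (∀ (PA : Fin n → Matrix (Fin dA) (Fin dA) ℂ) (PB : Fin n → Matrix (Fin dB) (Fin dB) ℂ),
      (∀ i, IsStarProjection (PA i)) → (∀ i, IsStarProjection (PB i)) →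
      LOCC.IsProjectiveMeasurement (fun i => PA i ⊗ₖ PB i) →
      LOCC.IsAsymptoticLOCC (fun i => PA i ⊗ₖ PB i) →
      LOCC.IsFiniteLOCC (fun i => PA i ⊗ₖ PB i)) ∧
    (∀ (τ : Fin n → Matrix (Fin dA) (Fin dA) ℂ) (σ : Fin n → Matrix (Fin dB) (Fin dB) ℂ),
      (∀ i, LOCC.IsState (τ i)) → (∀ i, LOCC.IsState (σ i)) →
      LOCC.IsFullOrthogonalSet (fun i => τ i ⊗ₖ σ i) →
      (∃ M, LOCC.IsAsymptoticLOCC M ∧ LOCC.Discriminates M (fun i => τ i ⊗ₖ σ i)) →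
      ∃ M, LOCC.IsFiniteLOCC M ∧ LOCC.Discriminates M (fun i => τ i ⊗ₖ σ i)) := by
  refine ⟨LOCC.asymptoticSuffices n dA dB, ?_⟩
  rintro τ σ hτ hσ hρ ⟨M, hM, hd⟩
  obtain ⟨PA, PB, hPA, hPB, hP, rfl⟩ :=
    LOCC.exists_projective_of_discriminates hτ hσ hρ hM.posSemidef hM.sum_eq_one hd
  exact ⟨_, LOCC.asymptoticSuffices n dA dB PA PB hPA hPB hP hM, hd⟩
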